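/- Let $L$ and $R$ be two disjoint sets of parties with $|L| = |R| = k$. The parties run a deterministic synchronous (round-based) protocol in the one-sided network: every pair of distinct parties is connected by an authenticated channel, except pairs within $L$. The setting is authenticated: every party has a signing key, everybody can verify signatures, and signatures are unforgeable. Every party holds as input a preference list, that is, a ranking of all $k$ parties on the other side; being matched to anybody is preferred to being alone. An adversary may permanently corrupt up to $t_L$ parties in $L$ and up to $t_R$ parties in $R$; corrupted (byzantine) parties deviate arbitrarily from the protocol, and a party is honest if it is never corrupted. A static adversary chooses the corrupted parties at the beginning, while an adaptive adversary may corrupt parties at any point of the execution. A protocol achieves byzantine stable matching ($\mathsf{bSM}$) with respect to $t_L, t_R$ if in each of its executions the following hold. Termination: every honest party outputs either a party on the opposite side or nobody. Symmetry: if $u, v$ are honest and $u$ outputs $v$, then $v$ outputs $u$. Stability: there are no honest $u \in L$, $v \in R$ who both prefer each other to their own outputs. Non-competition: no two distinct honest parties output the same party. $\mathsf{bSM}$ is solvable if some protocol achieves it. Theorem. (a) If $t_R < k$ or $t_L < k/3$, then $\mathsf{bSM}$ is solvable in the one-sided authenticated network, even against an adaptive adversary that is rushing and can read all channels. (b) Conversely,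 let $k \ge 2$. If $\mathsf{bSM}$ is solvable in the one-sided authenticated network, even if only against a static, non-rushing adversary that learns only the messages received by byzantine parties, then $t_R < k$ or $t_L < k/3$. -/

import Mathlib

/-! Byzantine stable matching in synchronous networks with digital signatures. -/

namespace ByzSM

/-- The `2k` parties: `Sum.inl i` is the `i`-th party of side `L`, `Sum.inr j` is the `j`-th
party of side `R`. -/
abbrev Party (k : ℕ) : Type := Fin k ⊕ Fin k

/-- The party with index `j` on the side opposite to `p`. -/
def opp {k : ℕ} : Party k → Fin k → Party k
  | Sum.inl _, j => Sum.inr j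
  | Sum.inr _, j => Sum.inl j

/-- The index of a party on its own side. -/
def idx {k : ℕ} : Party k → Fin k
  | Sum.inl i => i
  | Sum.inr j => j

/-- The one-sided network: all pairs of distinct parties are connected, except pairs within `L`. -/
def oneSided (k : ℕ) : SimpleGraph (Party k) where
  Adj p q := p ≠ q ∧ ¬ (p.isLeft = true ∧ q.isLeft = true)
  symm := ⟨fun _ _ h => ⟨h.1.symm, fun h' => h.2 ⟨h'.2, h'.1⟩⟩⟩
  loopless := ⟨fun _ h => h.1 rfl⟩

/-- A preference list over the opposite side: `π i` is the index of the party in position `i`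
(position `0` is the favorite). -/
abbrev Pref (k : ℕ) : Type := Equiv.Perm (Fin k)

/-- With preference list `π`, being matched to the party with index `v` is strictly better than
the current match (`none`: matched to nobody, the worst outcome). -/
def Prefers {k : ℕ} (π : Pref k) (v : Fin k) : Option (Fin k) → Prop
  | none => True
  | some w => π.symm v < π.symm w

/-- Messages. `signed p m` is the message `m` together with a signature of `p` on it. Data (bit
strings) are coded by natural numbers. Anybody can read and verify a message. -/
inductive Msg (k : ℕ) : Type
  | data : ℕ → Msg k
  | pair : Msg k → Msg k → Msg k
  | signed : Party k → Msg k → Msg k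

/-- The messages that can be produced by somebody who knows the messages in `K` and holds the
signing keys of exactly the parties in `S`: signatures are unforgeable, and they can be copied. -/
inductive Derivable {k : ℕ} (S : Set (Party k)) (K : Set (Msg k)) : Msg k → Prop
  | known {m : Msg k} : m ∈ K → Derivable S K m
  | data (n : ℕ) : Derivable S K (Msg.data n)
  | pair {a b : Msg k} : Derivable S K a → Derivable S K b → Derivable S K (Msg.pair a b)
  | fst {a b : Msg k} : Derivable S K (Msg.pair a b) → Derivable S K a
  | snd {a b : Msg k} : Derivable S K (Msg.pair a b) → Derivable S K b
  | sign {p : Party k} {m : Msg k} :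
      p ∈ S → Derivable S K m → Derivable S K (Msg.signed p m)
  | unsign {p : Party k} {m : Msg k} : Derivable S K (Msg.signed p m) → Derivable S K m

/-- The local view of a party after some number of rounds: the entry number `s` of the list tells
for every sender what was received from it in round `s` (`none`: no message). -/
abbrev View (k : ℕ) : Type := List (Party k → Option (Msg k))

/-- The messages received in a view. -/
def View.msgs {k : ℕ} (v : View k) : Set (Msg k) :=
  {m | ∃ f ∈ v, ∃ q, f q = some m}

/-- A deterministic synchronous protocol in the authenticated setting over the network `G`.
From its own input and its view of the earlier rounds, party `p` computes the message (if any)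
that it sends to `q` in the current round, and its output (`none`: no output yet; `some none`:
match nobody; `some (some j)`: match the party with index `j` on the opposite side).
Messages travel only along the edges of the network, and a party can sign only with its own key,
so that signatures of others can only be forwarded. -/
structure Protocol {k : ℕ} (G : SimpleGraph (Party k)) where
  send : Party k → Pref k → View k → Party k → Option (Msg k)
  output : Party k → Pref k → View k → Option (Option (Fin k))
  send_adj : ∀ p π v q m, send p π v q = some m → G.Adj p q
  send_legal : ∀ p π v q m, send p π v q = some m → Derivable {p} (View.msgs v) m

/-- A transcript: `sent r p q` is the message that `p` sends to `q` in round `r`, delivered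
before round `r + 1`. -/
abbrev Transcript (k : ℕ) : Type := ℕ → Party k → Party k → Option (Msg k)

/-- The view of `p` at the beginning of round `r`. -/
def viewAt {k : ℕ} (sent : Transcript k) (p : Party k) (r : ℕ) : View k :=
  (List.range r).map fun s q => sent s q p

/-- Kinds of adversaries: a static one chooses the byzantine parties at the beginning, an adaptive
one may corrupt parties at any point of the execution. -/
inductive Adversary : Type
  | static
  | adaptive

/-- The messages known to the adversary when the byzantine parties, `C r` in round `r`, send their
messages of round `r`.
A static adversary knows what the byzantine parties received in earlier rounds. An adaptive one is
also rushing and reads all channels (they are authenticated, not private): it knows all messages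
of earlier rounds, and the messages of the current round of parties that are not corrupted. -/
def known {k : ℕ} (C : ℕ → Finset (Party k)) (sent : Transcript k) (r : ℕ) :
    Adversary → Set (Msg k)
  | .static => {m | ∃ s, s < r ∧ ∃ p, ∃ q ∈ C r, sent s p q = some m}
  | .adaptive => {m | (∃ s, s < r ∧ ∃ p q, sent s p q = some m) ∨
      ∃ p, p ∉ C r ∧ ∃ q, sent r p q = some m}

/-- The executions of the protocol `P` on the given inputs in the presence of an adversary of the
given kind that corrupts at most `tL` parties in `L` and at most `tR` parties in `R`. Here `C r` is
the set of parties that are corrupted when the messages of round `r` are sent. Corruption is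
permanent. A party follows the protocol as long as it is not corrupted. A corrupted party sends
arbitrary messages (or none) to its neighbours, except that the adversary cannot forge signatures
of parties that are not corrupted. -/
structure IsExecution {k : ℕ} {G : SimpleGraph (Party k)} (P : Protocol G) (adv : Adversary)
    (tL tR : ℕ) (input : Party k → Pref k) (C : ℕ → Finset (Party k)) (sent : Transcript k) :
    Prop where
  permanent : Monotone C
  bound_left : ∀ r, (Finset.univ.filter fun i : Fin k => Sum.inl i ∈ C r).card ≤ tL
  bound_right : ∀ r, (Finset.univ.filter fun j : Fin k => Sum.inr j ∈ C r).card ≤ tR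
  static : adv = Adversary.static → ∀ r, C r = C 0
  follow : ∀ r, ∀ p, p ∉ C r → ∀ q, sent r p q = P.send p (input p) (viewAt sent p r) q
  byz_adj : ∀ r, ∀ p ∈ C r, ∀ q m, sent r p q = some m → G.Adj p q
  byz_derivable : ∀ r, ∀ p ∈ C r, ∀ q m, sent r p q = some m →
    Derivable (↑(C r) : Set (Party k)) (known C sent r adv) m

/-- A party is honest if it is never corrupted. -/
def Honest {k : ℕ} (C : ℕ → Finset (Party k)) (p : Party k) : Prop := ∀ r, p ∉ C r

/-- Running `P` on input `π` in the given transcript, `p` outputs `d`. The first output is final. -/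
def Outputs {k : ℕ} {G : SimpleGraph (Party k)} (P : Protocol G) (input : Party k → Pref k)
    (sent : Transcript k) (p : Party k) (d : Option (Fin k)) : Prop :=
  ∃ r, P.output p (input p) (viewAt sent p r) = some d ∧
    ∀ s < r, P.output p (input p) (viewAt sent p s) = none

/-- `P` achieves byzantine stable matching with respect to `tL` and `tR` against adversaries of
the given kind. -/
structure AchievesBSM {k : ℕ} {G : SimpleGraph (Party k)} (P : Protocol G) (adv : Adversary)
    (tL tR : ℕ) : Prop where
  /-- Every honest party outputs a party on the opposite side or nobody. -/
  termination : ∀ input C sent, IsExecution P adv tL tR input C sent →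
    ∀ p, Honest C p → ∃ d, Outputs P input sent p d
  /-- For honest `p` and `q`, if `p` outputs `q`, then `q` outputs `p`. -/
  symmetry : ∀ input C sent, IsExecution P adv tL tR input C sent →
    ∀ p j, Honest C p → Honest C (opp p j) →
      Outputs P input sent p (some j) → Outputs P input sent (opp p j) (some (idx p))
  /-- No two honest parties on opposite sides prefer each other over their matches. -/
  stability : ∀ input C sent, IsExecution P adv tL tR input C sent →
    ∀ i j, Honest C (Sum.inl i) → Honest C (Sum.inr j) →
      ∀ d e, Outputs P input sent (Sum.inl i) d → Outputs P input sent (Sum.inr j) e →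
        ¬ (Prefers (input (Sum.inl i)) j d ∧ Prefers (input (Sum.inr j)) i e)
  /-- No two honest parties output the same party. -/
  nonCompetition : ∀ input C sent, IsExecution P adv tL tR input C sent →
    ∀ p q, p ≠ q → Honest C p → Honest C q →
      ∀ i j, Outputs P input sent p (some i) → Outputs P input sent q (some j) →
        opp p i ≠ opp q j

/-- Byzantine stable matching is solvable in the authenticated network `G`. -/
def Solvable {k : ℕ} (G : SimpleGraph (Party k)) (adv : Adversary) (tL tR : ℕ) : Prop :=
  ∃ P : Protocol G, AchievesBSM P adv tL tR

end ByzSM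

namespace ByzSM

/-! ### Derivability, transcripts and outputs -/

/-! Impossibility. If all of `R` and a third of `L` may be corrupted, split `L` into three classes
by index modulo 3. In one world class 1 is silent and left party 0 must be matched to right party 0,
as mutual favorites; in another, class 0 is silent and left party 1 must be matched to right party
0. Now let `R` and class 2 be byzantine and play the first world towards class 0 and the second
towards class 1. Left parties cannot talk to each other, so neither class notices, and two honest
parties output the same partner. Signatures do not help: the keys missing for simulating a world
belong to its silent class or to a class whose messages all reach `R` (`derivable_of_simulation`,
`not_achievesBSM_static`).

Solvability. All parties broadcast their lists by a Dolev–Strong scheme, compute a stable matching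
of the agreed profile, and sign it. An honest right party is adjacent to everybody, so if there is
one, all honest parties agree on a profile containing the true honest inputs, hence on one stable
matching (`IsExecution.accepts_iff`, `IsExecution.decision_eq`). If all of `R` is corrupted, only
competition within `L` remains to be excluded. There a left party uses its matching only with `k -
tL` left signatures on it; for `3 * tL < k` any two such quorums share an honest signer, who signs a
single matching (`IsExecution.decision_injective`). Both arguments rest on unforgeability: an honest
signature in transit was produced by its owner (`IsExecution.sig_of_hasSig`). -/

theorem Derivable.trans {k : ℕ} {S S' : Set (Party k)} {K K' : Set (Msg k)} {m : Msg k}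
    (hS : S ⊆ S') (hK : ∀ x ∈ K, Derivable S' K' x) (h : Derivable S K m) :
    Derivable S' K' m := by
  induction h with
  | known h => exact hK _ h
  | data n => exact .data n
  | pair _ _ h₁ h₂ => exact .pair h₁ h₂
  | fst _ h => exact .fst h
  | snd _ h => exact .snd h
  | sign hp _ h => exact .sign (hS hp) h
  | unsign _ h => exact .unsign h

theorem viewAt_congr {k : ℕ} {T T' : Transcript k} {p : Party k} {r : ℕ}
    (h : ∀ s < r, ∀ q, T s q p = T' s q p) : viewAt T p r = viewAt T' p r := by
  refine List.map_congr_left fun s hs => ?_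
  funext q
  exact h s (List.mem_range.1 hs) q

theorem viewAt_succ {k : ℕ} (T : Transcript k) (p : Party k) (r : ℕ) :
    viewAt T p (r + 1) = viewAt T p r ++ [fun q => T r q p] := by
  simp [viewAt, List.range_succ]

theorem length_viewAt {k : ℕ} (T : Transcript k) (p : Party k) (r : ℕ) :
    (viewAt T p r).length = r := by
  simp [viewAt]

theorem take_viewAt {k : ℕ} (T : Transcript k) (p : Party k) {s r : ℕ} (h : s ≤ r) :
    (viewAt T p r).take s = viewAt T p s := by
  simp [viewAt, ← List.map_take, List.take_range, h]

theorem mem_msgs_viewAt {k : ℕ} {T : Transcript k} {p : Party k} {r : ℕ} {m : Msg k} :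
    m ∈ View.msgs (viewAt T p r) ↔ ∃ s < r, ∃ q, T s q p = some m := by
  simp [View.msgs, viewAt]

theorem Outputs.unique {k : ℕ} {G : SimpleGraph (Party k)} {P : Protocol G}
    {input : Party k → Pref k} {sent : Transcript k} {p : Party k} {d e : Option (Fin k)}
    (hd : Outputs P input sent p d) (he : Outputs P input sent p e) : d = e := by
  obtain ⟨r, hr, hr'⟩ := hd
  obtain ⟨s, hs, hs'⟩ := he
  rcases lt_trichotomy r s with h | rfl | h
  · simp [hs' r h] at hr
  · simpa [hr] using hs
  · simp [hr' s h] at hs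

theorem Outputs.congr_view {k : ℕ} {G : SimpleGraph (Party k)} {P : Protocol G}
    {input input' : Party k → Pref k} {T T' : Transcript k} {p : Party k} {d : Option (Fin k)}
    (hi : input p = input' p) (hv : ∀ r, viewAt T p r = viewAt T' p r)
    (h : Outputs P input T p d) : Outputs P input' T' p d := by
  obtain ⟨r, hr, hr'⟩ := h
  exact ⟨r, by rw [← hi, ← hv, hr], fun s hs => by rw [← hi, ← hv, hr' s hs]⟩

/-- The views when party `p` sends `F p v` after having seen the view `v`. -/
def runViews {k : ℕ} (F : Party k → View k → Party k → Option (Msg k)) : ℕ → Party k → View k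
  | 0, _ => []
  | r + 1, p => runViews F r p ++ [fun q => F q (runViews F r q) p]

theorem exists_transcript {k : ℕ} (F : Party k → View k → Party k → Option (Msg k)) :
    ∃ T : Transcript k, ∀ r p q, T r p q = F p (viewAt T p r) q := by
  let T : Transcript k := fun r p q => F p (runViews F r p) q
  have hT : ∀ r p, viewAt T p r = runViews F r p := by
    intro r
    induction r with
    | zero => intro p; rfl
    | succ r ih => intro p; rw [viewAt_succ, ih]; rfl
  exact ⟨T, fun r p q => by rw [hT]⟩

/-! ### Impossibility -/

/-- There is an execution in which the parties in `B` are byzantine and send nothing. -/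
theorem exists_silent_execution {k : ℕ} {G : SimpleGraph (Party k)} (P : Protocol G)
    (adv : Adversary) {tL tR : ℕ} (input : Party k → Pref k) (B : Finset (Party k))
    (hL : (Finset.univ.filter fun i : Fin k => Sum.inl i ∈ B).card ≤ tL)
    (hR : (Finset.univ.filter fun j : Fin k => Sum.inr j ∈ B).card ≤ tR) :
    ∃ T : Transcript k, IsExecution P adv tL tR input (fun _ => B) T ∧
      (∀ r, ∀ p ∈ B, ∀ q, T r p q = none) ∧
      ∀ r, ∀ p ∉ B, ∀ q, T r p q = P.send p (input p) (viewAt T p r) q := by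
  obtain ⟨T, hT⟩ := exists_transcript
    fun p v q => if p ∈ B then none else P.send p (input p) v q
  have hB : ∀ r, ∀ p ∈ B, ∀ q, T r p q = none := fun r p hp q => by simp [hT, hp]
  have hB' : ∀ r, ∀ p ∉ B, ∀ q, T r p q = P.send p (input p) (viewAt T p r) q :=
    fun r p hp q => by rw [hT, if_neg hp]
  refine ⟨T, ⟨fun _ _ _ => le_rfl, fun _ => hL, fun _ => hR, fun _ _ => rfl, hB', ?_, ?_⟩, hB, hB'⟩
  · intro r p hp q m h
    simp [hB r p hp q] at h
  · intro r p hp q m h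
    simp [hB r p hp q] at h

/-- Honest parties that are each other's favorites are matched. -/
theorem AchievesBSM.outputs_of_favorites {k : ℕ} {G : SimpleGraph (Party k)} {P : Protocol G}
    {adv : Adversary} {tL tR : ℕ} (hP : AchievesBSM P adv tL tR) {input : Party k → Pref k}
    {C : ℕ → Finset (Party k)} {T : Transcript k} (hT : IsExecution P adv tL tR input C T)
    {i j : Fin k} (hi : Honest C (Sum.inl i)) (hj : Honest C (Sum.inr j))
    (hij : ∀ w, (input (Sum.inl i)).symm j ≤ (input (Sum.inl i)).symm w)
    (hji : ∀ w, (input (Sum.inr j)).symm i ≤ (input (Sum.inr j)).symm w) :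
    Outputs P input T (Sum.inl i) (some j) := by
  have favorite : ∀ (π : Pref k) (v : Fin k), (∀ w, π.symm v ≤ π.symm w) →
      ∀ d, d ≠ some v → Prefers π v d := by
    rintro π v hv (_ | w) hd
    · trivial
    · refine lt_of_le_of_ne (hv w) fun h => hd ?_
      rw [π.symm.injective h]
  obtain ⟨d, hd⟩ := hP.termination input C T hT _ hi
  obtain ⟨e, he⟩ := hP.termination input C T hT _ hj
  by_cases hdj : d = some j
  · rwa [hdj] at hd
  · by_cases hei : e = some i
    · exact hP.symmetry input C T hT (Sum.inr j) i hj hi (hei ▸ he)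
    · exact absurd ⟨favorite _ _ hij d hdj, favorite _ _ hji e hei⟩
        (hP.stability input C T hT i j hi hj d e hd he)

theorem card_filter_mod_three_le {k t : ℕ} (h : k ≤ 3 * t) (c : ℕ) :
    (Finset.univ.filter fun i : Fin k => i.val % 3 = c).card ≤ t := by
  rw [← Finset.card_range t]
  refine Finset.card_le_card_of_injOn (fun i => i.val / 3) ?_ ?_
  · intro i _
    have := i.isLt
    simp only [Finset.coe_range, Set.mem_Iio]
    omega
  · intro i hi j hj hij
    simp only [Finset.coe_filter, Finset.mem_univ, true_and, Set.mem_ofPred_eq] at hi hj hij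
    ext
    omega

/-- The parties in `L` whose index is `c` modulo `3`. -/
def leftClass (k c : ℕ) : Finset (Party k) :=
  Finset.univ.filter fun p => p.isLeft = true ∧ (idx p).val % 3 = c

theorem inl_mem_leftClass {k c : ℕ} {i : Fin k} :
    (Sum.inl i : Party k) ∈ leftClass k c ↔ i.val % 3 = c := by
  rw [leftClass, Finset.mem_filter]
  simp [idx]

theorem inr_notMem_leftClass {k c : ℕ} {j : Fin k} : (Sum.inr j : Party k) ∉ leftClass k c := by
  simp [leftClass]

/-- If the messages of a party in `A` are received by byzantine parties, if the parties in `B` are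
silent and if all others are byzantine, then the byzantine parties can simulate everybody. -/
theorem derivable_of_simulation {k : ℕ} {G : SimpleGraph (Party k)} (P : Protocol G)
    {input : Party k → Pref k} {A B D : Finset (Party k)} {T sent : Transcript k}
    (hB : ∀ r, ∀ p ∈ B, ∀ q, T r p q = none)
    (hT : ∀ r, ∀ p ∉ B, ∀ q, T r p q = P.send p (input p) (viewAt T p r) q)
    (hA : ∀ r, ∀ p ∈ A, ∀ q m, T r p q = some m → q ∈ D ∧ sent r p q = some m)
    (hD : ∀ p, p ∈ A ∨ p ∈ B ∨ p ∈ D) (r : ℕ) :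
    ∀ p ∈ D, ∀ q m, T r p q = some m →
      Derivable (↑D : Set (Party k)) (known (fun _ => D) sent r .static) m := by
  induction r using Nat.strong_induction_on with
  | _ r ih =>
    intro p hp q m hm
    by_cases hpB : p ∈ B
    · simp [hB r p hpB q] at hm
    rw [hT r p hpB q] at hm
    refine Derivable.trans (by simpa using hp) ?_ (P.send_legal _ _ _ _ _ hm)
    intro x hx
    obtain ⟨s, hs, y, hy⟩ := mem_msgs_viewAt.1 hx
    rcases hD y with hyA | hyB | hyD
    · obtain ⟨h₁, h₂⟩ := hA s y hyA p x hy
      exact .known ⟨s, hs, y, p, h₁, h₂⟩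
    · simp [hB s y hyB p] at hy
    · refine Derivable.trans le_rfl ?_ (ih s hs y hyD p x hy)
      rintro z ⟨s', hs', w⟩
      exact .known ⟨s', hs'.trans hs, w⟩

/-- Two executions are glued along the missing edges within `L`; `k ≥ 2` provides left parties 0 and
1 in different classes. -/
theorem not_achievesBSM_static {k tL tR : ℕ} (hk : 2 ≤ k) (hL : k ≤ 3 * tL) (hR : k ≤ tR)
    (P : Protocol (oneSided k)) : ¬ AchievesBSM P .static tL tR := by
  intro hP
  let a : Fin k := ⟨0, by omega⟩
  let b : Fin k := ⟨1, by omega⟩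
  -- The index `i` only affects right lists, where the swap moves `i` to the top. Left parties
  -- therefore have the same input in both worlds.
  let inp : Fin k → Party k → Pref k :=
    fun i p => if p.isLeft then Equiv.refl _ else Equiv.swap a i
  have hinl : ∀ i i' l, inp i (Sum.inl l) = inp i' (Sum.inl l) := fun _ _ _ => rfl
  have hcardL : ∀ c, (Finset.univ.filter
      fun i : Fin k => (Sum.inl i : Party k) ∈ leftClass k c).card ≤ tL := by
    intro c
    simpa only [inl_mem_leftClass] using card_filter_mod_three_le hL c
  have hcardR : ∀ c, (Finset.univ.filter
      fun i : Fin k => (Sum.inr i : Party k) ∈ leftClass k c).card ≤ tR := by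
    intro c
    simp [inr_notMem_leftClass]
  obtain ⟨T₁, hE₁, hs₁, hf₁⟩ := exists_silent_execution P .static (inp a) (leftClass k 1)
    (hcardL 1) (hcardR 1)
  obtain ⟨T₂, hE₂, hs₂, hf₂⟩ := exists_silent_execution P .static (inp b) (leftClass k 0)
    (hcardL 0) (hcardR 0)
  have hout₁ : Outputs P (inp a) T₁ (Sum.inl a) (some a) := by
    refine hP.outputs_of_favorites hE₁ (fun _ => ?_) (fun _ => inr_notMem_leftClass) ?_ ?_
    · simp [inl_mem_leftClass, a]
    · intro w
      simp [inp, a, Fin.le_def]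
    · intro w
      simp [inp, a, Fin.le_def]
  have hout₂ : Outputs P (inp b) T₂ (Sum.inl b) (some a) := by
    refine hP.outputs_of_favorites hE₂ (fun _ => ?_) (fun _ => inr_notMem_leftClass) ?_ ?_
    · simp [inl_mem_leftClass, b]
    · intro w
      simp [inp, a, Fin.le_def]
    · intro w
      simp [inp, a, Fin.le_def]
  have hLL : ∀ (T : Transcript k) (i : Fin k) (B : Finset (Party k)),
      (∀ r, ∀ p ∈ B, ∀ q, T r p q = none) →
      (∀ r, ∀ p ∉ B, ∀ q, T r p q = P.send p (inp i p) (viewAt T p r) q) →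
      ∀ r p q m, T r p q = some m → (oneSided k).Adj p q := by
    intro T i B h₁ h₂ r p q m hm
    by_cases hp : p ∈ B
    · simp [h₁ r p hp q] at hm
    · exact P.send_adj _ _ _ _ _ (h₂ r p hp q ▸ hm)
  have hadj₁ := hLL T₁ a _ hs₁ hf₁
  have hadj₂ := hLL T₂ b _ hs₂ hf₂
  have hnone : ∀ {T : Transcript k}, (∀ r p q m, T r p q = some m → (oneSided k).Adj p q) →
      ∀ r i j, T r (Sum.inl i) (Sum.inl j) = none := by
    intro T hT r i j
    by_contra h
    obtain ⟨m, hm⟩ := Option.ne_none_iff_exists'.1 h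
    exact (hT _ _ _ _ hm).2 ⟨rfl, rfl⟩
  -- All of `R` and class 2 of `L`.
  let D : Finset (Party k) := Finset.univ.filter fun p => p ∉ leftClass k 0 ∧ p ∉ leftClass k 1
  let T : Transcript k := fun r p q =>
    if p ∈ leftClass k 0 then T₁ r p q
    else if p ∈ leftClass k 1 then T₂ r p q
    else if q ∈ leftClass k 0 then T₁ r p q
    else if q ∈ leftClass k 1 then T₂ r p q
    else none
  have h01 : ∀ p ∈ leftClass k 0, p ∉ leftClass k 1 := by
    intro p h₀ h₁
    simp only [leftClass, Finset.mem_filter] at h₀ h₁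
    omega
  have hTL : ∀ r i j, T r (Sum.inl i) (Sum.inl j) = none := by
    intro r i j
    simp [T, hnone hadj₁, hnone hadj₂]
  have hTadj : ∀ r p q m, T r p q = some m → (oneSided k).Adj p q := by
    intro r p q m h
    simp only [T] at h
    split_ifs at h
    all_goals first | exact hadj₁ _ _ _ _ h | exact hadj₂ _ _ _ _ h
  have hview₁ : ∀ p ∈ leftClass k 0, ∀ r, viewAt T₁ p r = viewAt T p r := by
    intro p hp r
    refine viewAt_congr fun s _ q => ?_
    rcases p with i | j
    · rcases q with i' | j'
      · rw [hnone hadj₁, hTL]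
      · simp [T, hp, inr_notMem_leftClass]
    · exact absurd hp inr_notMem_leftClass
  have hview₂ : ∀ p ∈ leftClass k 1, ∀ r, viewAt T₂ p r = viewAt T p r := by
    intro p hp r
    refine viewAt_congr fun s _ q => ?_
    rcases p with i | j
    · rcases q with i' | j'
      · rw [hnone hadj₂, hTL]
      · have : Sum.inl i ∉ leftClass k 0 := fun h => h01 _ h hp
        simp [T, hp, this, inr_notMem_leftClass]
    · exact absurd hp inr_notMem_leftClass
  -- Left parties send only to `R`, so the adversary receives every message of the two honest
  -- classes.
  have hdisj : ∀ (T' : Transcript k), (∀ r p q m, T' r p q = some m → (oneSided k).Adj p q) →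
      ∀ c r, ∀ p ∈ leftClass k c, ∀ q m, T' r p q = some m → q ∈ D := by
    intro T' hT' c r p hp q m hm
    rcases p with i | j
    · rcases q with i' | j'
      · simp [hnone hT'] at hm
      · simp [D, inr_notMem_leftClass]
    · exact absurd hp inr_notMem_leftClass
  have hder₁ := derivable_of_simulation P (A := leftClass k 0) (D := D) (sent := T) hs₁ hf₁
    (fun r p hp q m hm => ⟨hdisj T₁ hadj₁ 0 r p hp q m hm, by simpa [T, hp] using hm⟩)
    (fun p => by simp only [D, Finset.mem_filter, Finset.mem_univ, true_and]; tauto)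
  have hder₂ := derivable_of_simulation P (A := leftClass k 1) (D := D) (sent := T) hs₂ hf₂
    (fun r p hp q m hm => ⟨hdisj T₂ hadj₂ 1 r p hp q m hm, by
      have : p ∉ leftClass k 0 := fun h => h01 _ h hp
      simpa [T, hp, this] using hm⟩)
    (fun p => by simp only [D, Finset.mem_filter, Finset.mem_univ, true_and]; tauto)
  have hE : IsExecution P .static tL tR (inp a) (fun _ => D) T := by
    refine ⟨fun _ _ _ => le_rfl, fun _ => ?_, fun _ => ?_, fun _ _ => rfl, ?_,
      fun r p _ q m h => hTadj r p q m h, ?_⟩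
    · refine le_trans (Finset.card_le_card ?_) (card_filter_mod_three_le hL 2)
      intro i hi
      simp only [D, Finset.mem_filter, Finset.mem_univ, true_and, inl_mem_leftClass] at hi ⊢
      omega
    · exact (Finset.card_filter_le _ _).trans (by simpa using hR)
    · intro r p hp q
      by_cases hp₀ : p ∈ leftClass k 0
      · rw [← hview₁ p hp₀, ← hf₁ r p (h01 p hp₀)]
        simp [T, hp₀]
      · have hp₁ : p ∈ leftClass k 1 := by
          by_contra h
          exact hp (by simp [D, hp₀, h])
        have hinp : inp a p = inp b p := by
          rcases p with i | j
          · rfl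
          · exact absurd hp₁ inr_notMem_leftClass
        rw [← hview₂ p hp₁, hinp, ← hf₂ r p hp₀]
        simp [T, hp₀, hp₁]
    · intro r p hp q m hm
      have hp' := hp
      simp only [D, Finset.mem_filter, Finset.mem_univ, true_and] at hp'
      simp only [T, if_neg hp'.1, if_neg hp'.2] at hm
      split_ifs at hm
      · exact hder₁ r p hp q m hm
      · exact hder₂ r p hp q m hm
  have ha : (Sum.inl a : Party k) ∈ leftClass k 0 := by simp [inl_mem_leftClass, a]
  have hb : (Sum.inl b : Party k) ∈ leftClass k 1 := by simp [inl_mem_leftClass, b]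
  refine hP.nonCompetition (inp a) _ T hE (Sum.inl a) (Sum.inl b) (by simp [a, b])
    (fun _ => by simp [D, ha]) (fun _ => by simp [D, hb]) a a
    (hout₁.congr_view rfl (hview₁ _ ha)) (hout₂.congr_view (hinl b a b) (hview₂ _ hb)) rfl

/-! ### Stable matchings -/

/-- Every preference profile has a stable matching `σ`: party `i` of `L` is matched to party
`σ i` of `R`. -/
theorem exists_stable_matching {k : ℕ} (f g : Fin k → Pref k) :
    ∃ σ : Equiv.Perm (Fin k), ∀ i j, (f i).symm j < (f i).symm (σ i) →
      (g j).symm (σ.symm j) < (g j).symm i := by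
  classical
  -- `Proposes X i j`: when the pairs in `X` are rejected, `i` proposes to `j`.
  let Proposes : Finset (Fin k × Fin k) → Fin k → Fin k → Prop := fun X i j =>
    (i, j) ∉ X ∧ ∀ j', (f i).symm j' < (f i).symm j → (i, j') ∈ X
  -- Each rejection by `j` is justified by a standing proposal that `j` prefers. A largest such set
  -- plays the role of the final state of deferred acceptance.
  let Good : Finset (Fin k × Fin k) → Prop := fun X =>
    ∀ i j, (i, j) ∈ X → ∃ i', Proposes X i' j ∧ (g j).symm i' < (g j).symm i
  have huniq : ∀ X i j j', Proposes X i j → Proposes X i j' → j = j' := by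
    intro X i j j' h h'
    rcases lt_trichotomy ((f i).symm j) ((f i).symm j') with hlt | heq | hlt
    · exact absurd (h'.2 j hlt) h.1
    · exact (f i).symm.injective heq
    · exact absurd (h.2 j' hlt) h'.1
  obtain ⟨X, hX, hmax⟩ := (Finset.univ.filter Good).exists_max_image Finset.card
    ⟨∅, by simp [Good]⟩
  replace hX : Good X := by simpa using hX
  have hprop : ∀ i, ∃ j, Proposes X i j := by
    intro i
    by_cases h : ∃ j, (i, j) ∉ X
    · obtain ⟨j, hj, hmin⟩ := (Finset.univ.filter fun j => (i, j) ∉ X).exists_min_image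
        (fun j => (f i).symm j) (by obtain ⟨j, hj⟩ := h; exact ⟨j, by simpa using hj⟩)
      refine ⟨j, by simpa using hj, fun j' hj' => ?_⟩
      by_contra hc
      exact absurd (hmin j' (by simpa using hc)) (not_le.2 hj')
    · push Not at h
      -- If everybody rejected `i`, every `j` would have a justifying proposer. Each party proposes
      -- to at most one `j`, so by counting `i` is one of these proposers and would be preferred to
      -- itself.
      choose w hw hw' using fun j => hX i j (h j)
      have hinj : Function.Injective w := fun j j' hjj =>
        huniq X (w j) j j' (hw j) (hjj ▸ hw j')
      obtain ⟨j, hj⟩ := Finite.surjective_of_injective hinj i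
      exact absurd (hw' j) (by simp [hj])
  choose σ hσ using hprop
  -- Of two proposals to the same party the worse could be rejected as well, contradicting
  -- maximality. Rejections it justified are then justified by the better one.
  have key : ∀ i i', i ≠ i' → σ i = σ i' → ¬ (g (σ i)).symm i' < (g (σ i)).symm i := by
    intro i i' hne hii hlt
    have hsub : ∀ x j, x ≠ i → Proposes X x j → Proposes (insert (i, σ i) X) x j := by
      intro x j hx hj
      refine ⟨?_, fun j' hj' => Finset.mem_insert_of_mem (hj.2 j' hj')⟩
      simp [hx, hj.1]
    have hnew : Good (insert (i, σ i) X) := by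
      intro x j hx
      rcases Finset.mem_insert.1 hx with hx | hx
      · obtain ⟨rfl, rfl⟩ := Prod.mk.inj hx
        exact ⟨i', hsub i' _ hne.symm (hii ▸ hσ i'), hlt⟩
      · obtain ⟨y, hy, hy'⟩ := hX x j hx
        by_cases hyi : y = i
        · subst hyi
          obtain rfl := huniq X y j (σ y) hy (hσ y)
          exact ⟨i', hsub i' _ hne.symm (hii ▸ hσ i'), hlt.trans hy'⟩
        · exact ⟨y, hsub y j hyi hy, hy'⟩
    have := hmax _ (Finset.mem_filter.2 ⟨Finset.mem_univ _, hnew⟩)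
    rw [Finset.card_insert_of_notMem (hσ i).1] at this
    omega
  have hinj : Function.Injective σ := by
    intro i i' hii
    by_contra hne
    rcases lt_trichotomy ((g (σ i)).symm i) ((g (σ i)).symm i') with h | h | h
    · exact key i' i (Ne.symm hne) hii.symm (hii ▸ h)
    · exact hne ((g (σ i)).symm.injective h)
    · exact key i i' hne hii h
  refine ⟨Equiv.ofBijective σ (Finite.injective_iff_bijective.1 hinj), fun i j hij => ?_⟩
  obtain ⟨i', hi', hlt⟩ := hX i j ((hσ i).2 j hij)
  have : (Equiv.ofBijective σ (Finite.injective_iff_bijective.1 hinj)).symm j = i' := by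
    rw [Equiv.symm_apply_eq]
    exact huniq X i' j _ hi' (hσ i')
  rwa [this]

/-- A stable matching for the profile `f`. -/
noncomputable def stableMatching {k : ℕ} (f : Party k → Pref k) : Equiv.Perm (Fin k) :=
  (exists_stable_matching (fun i => f (Sum.inl i)) (fun j => f (Sum.inr j))).choose

theorem stableMatching_spec {k : ℕ} (f : Party k → Pref k) (i j : Fin k)
    (h : (f (Sum.inl i)).symm j < (f (Sum.inl i)).symm (stableMatching f i)) :
    (f (Sum.inr j)).symm ((stableMatching f).symm j) < (f (Sum.inr j)).symm i :=
  (exists_stable_matching (fun i => f (Sum.inl i)) (fun j => f (Sum.inr j))).choose_spec i j h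

/-! ### Gossip of signed statements -/

/-- The statements that parties sign: a preference list of a party, or a matching. -/
abbrev Stmt (k : ℕ) : Type := (Party k × Pref k) ⊕ Equiv.Perm (Fin k)

/-- The code of a statement. -/
noncomputable def Stmt.code {k : ℕ} (x : Stmt k) : ℕ := Fintype.equivFin (Stmt k) x

theorem Stmt.code_injective {k : ℕ} : Function.Injective (Stmt.code (k := k)) := fun _ _ h =>
  (Fintype.equivFin (Stmt k)).injective (Fin.ext h)

/-- The message contains the signature of `p` on the statement `x`. -/
def HasSig {k : ℕ} (p : Party k) (x : Stmt k) : Msg k → Prop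
  | .data _ => False
  | .pair a b => HasSig p x a ∨ HasSig p x b
  | .signed q m => (q = p ∧ m = .data x.code) ∨ HasSig p x m

/-- Unpacking a message needs no key, so any signature inside it can be extracted and relayed; this
makes gossip legal. -/
theorem HasSig.derivable {k : ℕ} {p : Party k} {x : Stmt k} {S : Set (Party k)} {K : Set (Msg k)}
    {m : Msg k} (h : HasSig p x m) (hm : Derivable S K m) :
    Derivable S K (.signed p (.data x.code)) := by
  induction m with
  | data n => exact h.elim
  | pair a b iha ihb => exact h.elim (fun h => iha h hm.fst) (fun h => ihb h hm.snd)
  | signed q m ih =>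
    rcases h with ⟨rfl, rfl⟩ | h
    · exact hm
    · exact ih h hm.unsign

/-- Signatures of parties outside `S` cannot be forged with the keys of `S`. -/
theorem Derivable.hasSig {k : ℕ} {S : Set (Party k)} {K : Set (Msg k)} {m : Msg k}
    (hm : Derivable S K m) {p : Party k} {x : Stmt k} (hp : p ∉ S) (h : HasSig p x m) :
    ∃ m' ∈ K, HasSig p x m' := by
  induction hm with
  | known hK => exact ⟨_, hK, h⟩
  | data n => exact h.elim
  | pair _ _ iha ihb => exact h.elim iha ihb
  | fst _ ih => exact ih (.inl h)
  | snd _ ih => exact ih (.inr h)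
  | sign hq _ ih =>
    rcases h with ⟨rfl, _⟩ | h
    · exact absurd hq hp
    · exact ih h
  | unsign _ ih => exact ih (.inr h)

/-- A message that consists of the signatures in a list. -/
noncomputable def bundle {k : ℕ} : List (Party k × Stmt k) → Msg k
  | [] => .data 0
  | y :: l => .pair (.signed y.1 (.data y.2.code)) (bundle l)

theorem hasSig_bundle {k : ℕ} {p : Party k} {x : Stmt k} {l : List (Party k × Stmt k)} :
    HasSig p x (bundle l) ↔ (p, x) ∈ l := by
  induction l with
  | nil => simp [bundle, HasSig]
  | cons y l ih =>
    simp only [bundle, HasSig, ih, List.mem_cons, Msg.data.injEq, or_false,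
      Stmt.code_injective.eq_iff, Prod.ext_iff]
    simp only [eq_comm]

theorem derivable_bundle {k : ℕ} {S : Set (Party k)} {K : Set (Msg k)}
    {l : List (Party k × Stmt k)}
    (h : ∀ y ∈ l, Derivable S K (.signed y.1 (.data y.2.code))) : Derivable S K (bundle l) := by
  induction l with
  | nil => exact .data 0
  | cons y l ih =>
    exact .pair (h y List.mem_cons_self) (ih fun z hz => h z (List.mem_cons_of_mem _ hz))

/-- The signature of `p` on `x` has been received in the view `v`. -/
def Knows {k : ℕ} (v : View k) (p : Party k) (x : Stmt k) : Prop :=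
  ∃ m ∈ View.msgs v, HasSig p x m

theorem knows_viewAt {k : ℕ} {T : Transcript k} {p q : Party k} {r : ℕ} {x : Stmt k} :
    Knows (viewAt T q r) p x ↔ ∃ s < r, ∃ y m, T s y q = some m ∧ HasSig p x m := by
  simp only [Knows, mem_msgs_viewAt]
  constructor
  · rintro ⟨m, ⟨s, hs, y, hy⟩, hm⟩
    exact ⟨s, hs, y, m, hy, hm⟩
  · rintro ⟨s, hs, y, m, hy, hm⟩
    exact ⟨m, ⟨s, hs, y, hy⟩, hm⟩

open Classical in
/-- The protocol in which every party sends to all its neighbours, in every round, all signatures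
that it has received so far and its own signatures on the statements chosen by `sig`. -/
noncomputable def gossip {k : ℕ} (G : SimpleGraph (Party k))
    (sig : Party k → Pref k → View k → Stmt k → Prop)
    (output : Party k → Pref k → View k → Option (Option (Fin k))) : Protocol G where
  send p π v q :=
    if G.Adj p q then
      some (bundle (Finset.univ.filter fun y : Party k × Stmt k =>
        Knows v y.1 y.2 ∨ (y.1 = p ∧ sig p π v y.2)).toList)
    else none
  output := output
  send_adj p π v q m h := by
    by_contra hc
    simp [hc] at h
  send_legal p π v q m h := by
    split_ifs at h
    obtain rfl := Option.some.inj h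
    refine derivable_bundle fun y hy => ?_
    simp only [Finset.mem_toList, Finset.mem_filter, Finset.mem_univ, true_and] at hy
    rcases hy with ⟨m, hm, hy⟩ | ⟨hy, _⟩
    · exact hy.derivable (.known hm)
    · exact .sign hy (.data _)

section Gossip

variable {k : ℕ} {G : SimpleGraph (Party k)} {sig : Party k → Pref k → View k → Stmt k → Prop}
  {output : Party k → Pref k → View k → Option (Option (Fin k))} {adv : Adversary} {tL tR : ℕ}
  {input : Party k → Pref k} {C : ℕ → Finset (Party k)} {sent : Transcript k}

/-- Signatures of honest parties in transmitted messages are genuine. -/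
theorem IsExecution.sig_of_hasSig
    (h : IsExecution (gossip G sig output) .adaptive tL tR input C sent) {q : Party k}
    (hq : Honest C q) {x : Stmt k} (r : ℕ) :
    ∀ a b m, sent r a b = some m → HasSig q x m →
      ∃ s ≤ r, sig q (input q) (viewAt sent q s) x := by
  induction r using Nat.strong_induction_on with
  | _ r ih =>
    -- Uncorrupted senders come first: a rushing adversary may reuse their messages of the same
    -- round.
    have hgood : ∀ a b m, a ∉ C r → sent r a b = some m → HasSig q x m →
        ∃ s ≤ r, sig q (input q) (viewAt sent q s) x := by
      intro a b m ha hm hx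
      rw [h.follow r a ha b] at hm
      simp only [gossip] at hm
      split_ifs at hm
      obtain rfl := Option.some.inj hm
      simp only [hasSig_bundle, Finset.mem_toList, Finset.mem_filter, Finset.mem_univ,
        true_and] at hx
      rcases hx with hx | ⟨rfl, hx⟩
      · obtain ⟨s, hs, y, m, hy, hm⟩ := knows_viewAt.1 hx
        obtain ⟨s', hs', hsig⟩ := ih s hs y a m hy hm
        exact ⟨s', hs'.trans hs.le, hsig⟩
      · exact ⟨r, le_rfl, hx⟩
    intro a b m hm hx
    by_cases ha : a ∈ C r
    · obtain ⟨m', hm', hx'⟩ := (h.byz_derivable r a ha b m hm).hasSig (by simpa using hq r) hx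
      rcases hm' with ⟨s, hs, y, z, hyz⟩ | ⟨y, hy, z, hyz⟩
      · obtain ⟨s', hs', hsig⟩ := ih s hs y z m' hyz hx'
        exact ⟨s', hs'.trans hs.le, hsig⟩
      · exact hgood y z m' hy hyz hx'
    · exact hgood a b m ha hm hx

theorem IsExecution.sig_of_knows
    (h : IsExecution (gossip G sig output) .adaptive tL tR input C sent) {p q : Party k}
    (hq : Honest C q) {x : Stmt k} {r : ℕ} (hx : Knows (viewAt sent p r) q x) :
    ∃ s < r, sig q (input q) (viewAt sent q s) x := by
  obtain ⟨s, hs, y, m, hy, hm⟩ := knows_viewAt.1 hx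
  obtain ⟨s', hs', hsig⟩ := h.sig_of_hasSig hq s y p m hy hm
  exact ⟨s', hs'.trans_lt hs, hsig⟩

/-- Honest parties pass on to their neighbours all signatures that they know or produce. -/
theorem IsExecution.knows_succ
    (h : IsExecution (gossip G sig output) adv tL tR input C sent) {p q y : Party k}
    (hp : Honest C p) (hpq : G.Adj p q) {x : Stmt k} {r : ℕ}
    (hx : Knows (viewAt sent p r) y x ∨ (y = p ∧ sig p (input p) (viewAt sent p r) x)) :
    Knows (viewAt sent q (r + 1)) y x := by
  refine knows_viewAt.2 ⟨r, r.lt_succ_self, p, _, (h.follow r p (hp r) q).trans (if_pos hpq), ?_⟩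
  simpa [hasSig_bundle] using hx

end Gossip

/-! ### The protocol -/

open Classical in
/-- Party `p` with input `π` accepts, by the end of the view `v`, that `s` has announced the
preference list `w`: this is its own input, or after some number `r` of rounds it knew signatures
of `r` parties, among them `s`, on this announcement. -/
def Accepts {k : ℕ} (p : Party k) (π : Pref k) (v : View k) (s : Party k) (w : Pref k) : Prop :=
  (s = p ∧ w = π) ∨ ∃ r ≤ v.length, Knows (v.take r) s (.inl (s, w)) ∧
    r ≤ (Finset.univ.filter fun q => Knows (v.take r) q (.inl (s, w))).card

open Classical in
/-- The profile determined by the accepted announcements `A`. -/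
noncomputable def profile {k : ℕ} (A : Party k → Pref k → Prop) (s : Party k) : Pref k :=
  -- With no accepted list, or several, the fixed list `1` is used, so equal acceptances always give
  -- equal profiles.
  if h : ∃ w, ∀ w', A s w' ↔ w' = w then h.choose else 1

theorem profile_eq {k : ℕ} {A : Party k → Pref k → Prop} {s : Party k} {w : Pref k}
    (h : ∀ w', A s w' ↔ w' = w) : profile A s = w := by
  have h' : ∃ w, ∀ w', A s w' ↔ w' = w := ⟨w, h⟩
  rw [profile, dif_pos h']
  exact (h _).1 ((h'.choose_spec _).2 rfl)

/-- The matching computed from the announcements accepted in the first `2 * k` rounds. -/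
noncomputable def matchingOf {k : ℕ} (p : Party k) (π : Pref k) (v : View k) :
    Equiv.Perm (Fin k) :=
  -- The truncation keeps the matching constant from round `2 * k` on, so an honest party never
  -- signs two different ones.
  stableMatching (profile (Accepts p π (v.take (2 * k))))

/-- The statements signed by a party: the announcements that it accepts and, after `2 * k` rounds,
the matching that it has computed. -/
def signs {k : ℕ} (p : Party k) (π : Pref k) (v : View k) : Stmt k → Prop
  | .inl y => Accepts p π v y.1 y.2
  | .inr σ => 2 * k ≤ v.length ∧ σ = matchingOf p π v

open Classical in
/-- The decision of a party. A party in `L` uses the matching that it has computed only if at least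
`k - tL` parties in `L` have signed this matching. -/
noncomputable def decision {k : ℕ} (tL : ℕ) (p : Party k) (π : Pref k) (v : View k) :
    Option (Fin k) :=
  match p with
  | .inl i =>
    if k - tL ≤ (Finset.univ.filter fun l : Fin k =>
        Knows v (Sum.inl l) (.inr (matchingOf (Sum.inl i) π v))).card
    then some (matchingOf (Sum.inl i) π v i) else none
  | .inr j => some ((matchingOf (Sum.inr j) π v).symm j)

/-- The protocol: signed announcements are spread for `2 * k` rounds, signed matchings for two more
rounds. -/
noncomputable def matchingProtocol (k tL : ℕ) : Protocol (oneSided k) :=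
  gossip (oneSided k) signs fun p π v =>
    if v.length < 2 * k + 2 then none else some (decision tL p π v)

section Correctness

variable {k tL tR : ℕ} {input : Party k → Pref k} {C : ℕ → Finset (Party k)}
  {sent : Transcript k}

theorem outputs_matchingProtocol {p : Party k} {d : Option (Fin k)} :
    Outputs (matchingProtocol k tL) input sent p d ↔
      d = decision tL p (input p) (viewAt sent p (2 * k + 2)) := by
  have h : Outputs (matchingProtocol k tL) input sent p
      (decision tL p (input p) (viewAt sent p (2 * k + 2))) :=
    ⟨2 * k + 2, by simp [matchingProtocol, gossip, length_viewAt],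
      fun s hs => by simp [matchingProtocol, gossip, length_viewAt, hs]⟩
  exact ⟨fun hd => hd.unique h, fun hd => hd ▸ h⟩

open Classical in
theorem accepts_viewAt {p : Party k} {π : Pref k} {r : ℕ} {s : Party k} {w : Pref k} :
    Accepts p π (viewAt sent p r) s w ↔ (s = p ∧ w = π) ∨
      ∃ r' ≤ r, Knows (viewAt sent p r') s (.inl (s, w)) ∧
        r' ≤ (Finset.univ.filter fun q => Knows (viewAt sent p r') q (.inl (s, w))).card := by
  simp only [Accepts, length_viewAt]
  refine or_congr_right (exists_congr fun r' => and_congr_right fun hr' => ?_)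
  rw [take_viewAt sent p hr']

/-- What an honest party accepts is accepted by its honest neighbours. -/
theorem IsExecution.accepts_of_adj
    (h : IsExecution (matchingProtocol k tL) .adaptive tL tR input C sent) {p q : Party k}
    (hp : Honest C p) (hpq : (oneSided k).Adj p q) {r : ℕ} {s : Party k} {w : Pref k}
    (hA : Accepts p (input p) (viewAt sent p r) s w) :
    Accepts q (input q) (viewAt sent q (2 * k)) s w := by
  classical
  have hex : ∃ r, Accepts p (input p) (viewAt sent p r) s w := ⟨r, hA⟩
  -- At the first acceptance `p` has not yet signed, so its signature is a new one for `q`.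
  obtain ⟨r, hr, hmin⟩ : ∃ r, Accepts p (input p) (viewAt sent p r) s w ∧
      ∀ r' < r, ¬ Accepts p (input p) (viewAt sent p r') s w :=
    ⟨Nat.find hex, Nat.find_spec hex, fun r' hr' => Nat.find_min hex hr'⟩
  let Q : Finset (Party k) := Finset.univ.filter fun y => Knows (viewAt sent p r) y (.inl (s, w))
  have hpQ : p ∉ Q := by
    intro hpQ
    obtain ⟨r', hr', hs⟩ := h.sig_of_knows hp (by simpa [Q] using hpQ)
    exact hmin r' hr' hs
  have hQ : (s = p ∨ s ∈ Q) ∧ r ≤ Q.card := by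
    have hr₀ := hr
    rw [accepts_viewAt] at hr
    rcases hr with ⟨rfl, hw⟩ | ⟨r', hr', hs, hc⟩
    · refine ⟨.inl rfl, ?_⟩
      by_contra hlt
      exact hmin 0 (by omega) (.inl ⟨rfl, hw⟩)
    · obtain rfl : r' = r := by
        by_contra hne
        exact hmin r' (by omega) (accepts_viewAt.2 (.inr ⟨r', le_rfl, hs, hc⟩))
      exact ⟨.inr (by simpa [Q] using hs), hc⟩
  -- The round number and the number of signatures both grow by one. As there are only `2 * k`
  -- signers, round `r + 1` is still within the `2 * k` rounds.
  have hcard : (insert p Q).card = Q.card + 1 := Finset.card_insert_of_notMem hpQ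
  have hle : (insert p Q).card ≤ 2 * k := by
    refine (Finset.card_le_univ _).trans (by simp [two_mul])
  have hsub : ∀ y ∈ insert p Q, Knows (viewAt sent q (r + 1)) y (.inl (s, w)) := by
    intro y hy
    refine h.knows_succ hp hpq ?_
    rcases Finset.mem_insert.1 hy with rfl | hy
    · exact .inr ⟨rfl, hr⟩
    · exact .inl (by simpa [Q] using hy)
  refine accepts_viewAt.2 (.inr ⟨r + 1, by omega, hsub s ?_, ?_⟩)
  · rcases hQ.1 with rfl | hs
    · exact Finset.mem_insert_self _ _
    · exact Finset.mem_insert_of_mem hs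
  · calc r + 1 ≤ (insert p Q).card := by omega
      _ ≤ _ := Finset.card_le_card fun y hy => by simpa using hsub y hy

theorem oneSided_adj_inr {p : Party k} {j : Fin k} (h : p ≠ Sum.inr j) :
    (oneSided k).Adj p (Sum.inr j) := ⟨h, by simp⟩

/-- If some party in `R` is honest, then all honest parties accept the same announcements. -/
theorem IsExecution.accepts_iff
    (h : IsExecution (matchingProtocol k tL) .adaptive tL tR input C sent) {j : Fin k}
    (hj : Honest C (Sum.inr j)) {p q : Party k} (hp : Honest C p) (hq : Honest C q)
    (s : Party k) (w : Pref k) :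
    Accepts p (input p) (viewAt sent p (2 * k)) s w ↔
      Accepts q (input q) (viewAt sent q (2 * k)) s w := by
  have key : ∀ p, Honest C p → (Accepts p (input p) (viewAt sent p (2 * k)) s w ↔
      Accepts (Sum.inr j) (input (Sum.inr j)) (viewAt sent (Sum.inr j) (2 * k)) s w) := by
    intro p hp
    by_cases hpj : p = Sum.inr j
    · rw [hpj]
    · exact ⟨h.accepts_of_adj hp (oneSided_adj_inr hpj),
        h.accepts_of_adj hj (oneSided_adj_inr hpj).symm⟩
  rw [key p hp, key q hq]

/-- Accepting one's own announcement through signatures requires one's own signature on it, hence an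
earlier acceptance; the descent ends at the input. -/
theorem IsExecution.eq_input_of_accepts
    (h : IsExecution (matchingProtocol k tL) .adaptive tL tR input C sent) {s : Party k}
    (hs : Honest C s) {w : Pref k} (r : ℕ)
    (hA : Accepts s (input s) (viewAt sent s r) s w) : w = input s := by
  induction r using Nat.strong_induction_on with
  | _ r ih =>
    rcases accepts_viewAt.1 hA with ⟨_, hw⟩ | ⟨r', hr', hk, _⟩
    · exact hw
    · obtain ⟨r'', hr'', hsig⟩ := h.sig_of_knows hs hk
      exact ih r'' (hr''.trans_le hr') hsig

/-- If some party in `R` is honest, then the accepted profile contains the inputs of all honest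
parties. -/
theorem IsExecution.profile_eq_input
    (h : IsExecution (matchingProtocol k tL) .adaptive tL tR input C sent) {j : Fin k}
    (hj : Honest C (Sum.inr j)) {p s : Party k} (hp : Honest C p) (hs : Honest C s) :
    profile (Accepts p (input p) (viewAt sent p (2 * k))) s = input s := by
  refine profile_eq fun w => ?_
  rw [h.accepts_iff hj hp hs]
  exact ⟨h.eq_input_of_accepts hs _, fun hw => .inl ⟨rfl, hw⟩⟩

theorem matchingOf_viewAt {p : Party k} {π : Pref k} {r : ℕ} (hr : 2 * k ≤ r) :
    matchingOf p π (viewAt sent p r) =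
      stableMatching (profile (Accepts p π (viewAt sent p (2 * k)))) := by
  rw [matchingOf, take_viewAt sent p hr]

/-- There is a time after which no party becomes corrupted. -/
theorem exists_forall_mem_or_honest (hC : Monotone C) :
    ∃ r, ∀ p : Party k, p ∈ C r ∨ Honest C p := by
  have hex : ∀ p : Party k, ∃ r, p ∈ C r ∨ Honest C p := by
    intro p
    by_cases hp : Honest C p
    · exact ⟨0, .inr hp⟩
    · simp only [Honest, not_forall, not_not] at hp
      exact hp.imp fun _ => .inl
  choose f hf using hex
  refine ⟨Finset.univ.sup f, fun p => (hf p).imp_left fun h => ?_⟩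
  exact hC (Finset.le_sup (Finset.mem_univ p)) h

-- Corruptions stop at some round, and the bound at that round counts all parties that are ever
-- corrupted.
open Classical in
theorem IsExecution.le_card_honest_left {P : Protocol (oneSided k)} {adv : Adversary}
    (h : IsExecution P adv tL tR input C sent) :
    k - tL ≤ (Finset.univ.filter fun i : Fin k => Honest C (Sum.inl i)).card := by
  obtain ⟨r, hr⟩ := exists_forall_mem_or_honest h.permanent
  have h₁ := h.bound_left r
  have h₂ := Finset.card_filter_add_card_filter_not (s := (Finset.univ : Finset (Fin k)))
    (fun i => Sum.inl i ∈ C r)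
  have h₃ : (Finset.univ.filter fun i : Fin k => Sum.inl i ∉ C r).card ≤
      (Finset.univ.filter fun i : Fin k => Honest C (Sum.inl i)).card :=
    Finset.card_le_card fun i hi => by
      simp only [Finset.mem_filter, Finset.mem_univ, true_and] at hi ⊢
      exact (hr _).resolve_left hi
  rw [Finset.card_univ, Fintype.card_fin] at h₂
  omega

theorem IsExecution.exists_honest_right {P : Protocol (oneSided k)} {adv : Adversary}
    (h : IsExecution P adv tL tR input C sent) (htR : tR < k) :
    ∃ j : Fin k, Honest C (Sum.inr j) := by
  obtain ⟨r, hr⟩ := exists_forall_mem_or_honest h.permanent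
  by_contra! hc
  have := h.bound_right r
  rw [Finset.filter_true_of_mem fun j _ => (hr _).resolve_right (hc j), Finset.card_univ,
    Fintype.card_fin] at this
  omega

/-- If some party in `R` is honest, then all honest parties decide according to the same stable
matching. -/
theorem IsExecution.decision_eq
    (h : IsExecution (matchingProtocol k tL) .adaptive tL tR input C sent) {j : Fin k}
    (hj : Honest C (Sum.inr j)) :
    ∃ f : Party k → Pref k, (∀ p, Honest C p → f p = input p) ∧
      (∀ i, Honest C (Sum.inl i) → decision tL (Sum.inl i) (input (Sum.inl i))
        (viewAt sent (Sum.inl i) (2 * k + 2)) = some (stableMatching f i)) ∧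
      ∀ i, Honest C (Sum.inr i) → decision tL (Sum.inr i) (input (Sum.inr i))
        (viewAt sent (Sum.inr i) (2 * k + 2)) = some ((stableMatching f).symm i) := by
  classical
  let f := profile (Accepts (Sum.inr j) (input (Sum.inr j)) (viewAt sent (Sum.inr j) (2 * k)))
  have hM : ∀ p, Honest C p → ∀ r, 2 * k ≤ r →
      matchingOf p (input p) (viewAt sent p r) = stableMatching f := by
    intro p hp r hr
    rw [matchingOf_viewAt hr]
    congr 2
    funext s w
    exact propext (h.accepts_iff hj hp hj s w)
  refine ⟨f, fun p hp => h.profile_eq_input hj hj hp, fun i hi => ?_, fun i hi => ?_⟩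
  · rw [decision, hM _ hi _ (by omega), if_pos]
    refine h.le_card_honest_left.trans (Finset.card_le_card fun l hl => ?_)
    simp only [Finset.mem_filter, Finset.mem_univ, true_and] at hl ⊢
    -- Left signatures travel in two hops, via the honest right party; hence the two extra rounds.
    have h₁ : Knows (viewAt sent (Sum.inr j) (2 * k + 1)) (Sum.inl l) (.inr (stableMatching f)) :=
      h.knows_succ hl (oneSided_adj_inr (by simp))
        (.inr ⟨rfl, (length_viewAt _ _ _).ge, (hM _ hl _ le_rfl).symm⟩)
    exact h.knows_succ hj (oneSided_adj_inr (by simp)).symm (.inl h₁)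
  · rw [decision, hM _ hi _ (by omega)]

/-- If fewer than a third of the parties in `L` are corrupted, then honest parties in `L` never
decide for the same party. -/
theorem IsExecution.decision_injective
    (h : IsExecution (matchingProtocol k tL) .adaptive tL tR input C sent) (htL : 3 * tL < k)
    {i i' v : Fin k}
    (hv : decision tL (Sum.inl i) (input (Sum.inl i)) (viewAt sent (Sum.inl i) (2 * k + 2)) =
      some v)
    (hv' : decision tL (Sum.inl i') (input (Sum.inl i')) (viewAt sent (Sum.inl i') (2 * k + 2)) =
      some v) : i = i' := by
  classical
  simp only [decision] at hv hv'
  split_ifs at hv hv' with hq hq'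
  generalize matchingOf (Sum.inl i) _ _ = σ at hv hq
  generalize matchingOf (Sum.inl i') _ _ = σ' at hv' hq'
  let S₁ := Finset.univ.filter fun l : Fin k =>
    Knows (viewAt sent (Sum.inl i) (2 * k + 2)) (Sum.inl l) (.inr σ)
  let S₂ := Finset.univ.filter fun l : Fin k =>
    Knows (viewAt sent (Sum.inl i') (2 * k + 2)) (Sum.inl l) (.inr σ')
  let S₃ := Finset.univ.filter fun l : Fin k => Honest C (Sum.inl l)
  change k - tL ≤ S₁.card at hq
  change k - tL ≤ S₂.card at hq'
  -- Three subsets of a `k`-set, each missing at most `tL` elements, have a common element because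
  -- `3 * tL < k`.
  have hq₃ : k - tL ≤ S₃.card := h.le_card_honest_left
  have h₁ := Finset.card_union_add_card_inter S₁ S₂
  have h₂ := Finset.card_union_add_card_inter (S₁ ∩ S₂) S₃
  have h₃ := Finset.card_le_univ (S₁ ∪ S₂)
  have h₄ := Finset.card_le_univ (S₁ ∩ S₂ ∪ S₃)
  rw [Fintype.card_fin] at h₃ h₄
  obtain ⟨l, hl⟩ : (S₁ ∩ S₂ ∩ S₃).Nonempty := Finset.card_pos.1 (by omega)
  simp only [S₁, S₂, S₃, Finset.mem_inter, Finset.mem_filter, Finset.mem_univ, true_and] at hl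
  obtain ⟨⟨hl₁, hl₂⟩, hl₃⟩ := hl
  obtain ⟨s, _, hs, hσ⟩ := h.sig_of_knows hl₃ hl₁
  obtain ⟨s', _, hs', hσ'⟩ := h.sig_of_knows hl₃ hl₂
  rw [length_viewAt] at hs hs'
  rw [matchingOf_viewAt hs] at hσ
  rw [matchingOf_viewAt hs'] at hσ'
  exact σ.injective (by rw [Option.some.inj hv, hσ.trans hσ'.symm, Option.some.inj hv'])

/-- Symmetry, stability and competition between right parties all involve an honest right party, so
`IsExecution.decision_eq` settles them. The hypothesis matters only for two left parties. -/
theorem achievesBSM_matchingProtocol (hlt : tR < k ∨ 3 * tL < k) :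
    AchievesBSM (matchingProtocol k tL) .adaptive tL tR := by
  refine ⟨fun input C sent _ p _ => ⟨_, outputs_matchingProtocol.2 rfl⟩, ?_, ?_, ?_⟩
  · intro input C sent h p j hp hj ho
    rw [outputs_matchingProtocol] at ho ⊢
    rcases p with i | i
    · obtain ⟨f, _, hl, hr⟩ := h.decision_eq hj
      rw [hl i hp] at ho
      simp only [opp, idx]
      rw [hr j hj, Option.some.inj ho, Equiv.symm_apply_apply]
    · obtain ⟨f, _, hl, hr⟩ := h.decision_eq hp
      rw [hr i hp] at ho
      simp only [opp, idx]
      rw [hl j hj, Option.some.inj ho, Equiv.apply_symm_apply]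
  · rintro input C sent h i j hi hj d e hd he ⟨hp, hp'⟩
    rw [outputs_matchingProtocol] at hd he
    obtain ⟨f, hf, hl, hr⟩ := h.decision_eq hj
    rw [hl i hi] at hd
    rw [hr j hj] at he
    subst hd he
    rw [← hf _ hi] at hp
    rw [← hf _ hj] at hp'
    exact lt_asymm hp' (stableMatching_spec f i j hp)
  · intro input C sent h p q hpq hp hq i j hi hj hij
    rw [outputs_matchingProtocol] at hi hj
    rcases p with a | a <;> rcases q with b | b <;> simp only [opp, reduceCtorEq] at hij
    · obtain rfl := Sum.inr.inj hij
      refine hpq (congrArg Sum.inl ?_)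
      by_cases hR : ∃ j, Honest C (Sum.inr j)
      · obtain ⟨c, hc⟩ := hR
        obtain ⟨f, _, hl, _⟩ := h.decision_eq hc
        rw [hl _ hp] at hi
        rw [hl _ hq] at hj
        exact (stableMatching f).injective (Option.some.inj (hi.symm.trans hj))
      · have htL := hlt.resolve_left fun htR => hR (h.exists_honest_right htR)
        exact h.decision_injective htL hi.symm hj.symm
    · obtain rfl := Sum.inl.inj hij
      refine hpq (congrArg Sum.inr ?_)
      obtain ⟨f, _, _, hr⟩ := h.decision_eq hp
      rw [hr _ hp] at hi
      rw [hr _ hq] at hj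
      exact (stableMatching f).symm.injective (Option.some.inj (hi.symm.trans hj))

end Correctness

end ByzSM

theorem mainTheorem5 (k tL tR : ℕ) :
    ((tR < k ∨ (tL : ℝ) < (k : ℝ) / 3) →
      ByzSM.Solvable (ByzSM.oneSided k) ByzSM.Adversary.adaptive tL tR) ∧
    (2 ≤ k → ByzSM.Solvable (ByzSM.oneSided k) ByzSM.Adversary.static tL tR →
      (tR < k ∨ (tL : ℝ) < (k : ℝ) / 3)) := by
  have hiff : (tL : ℝ) < (k : ℝ) / 3 ↔ 3 * tL < k := by
    rw [lt_div_iff₀ (by norm_num), mul_comm]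
    exact_mod_cast Iff.rfl
  rw [hiff]
  refine ⟨fun h => ⟨_, ByzSM.achievesBSM_matchingProtocol h⟩, fun hk ⟨P, hP⟩ => ?_⟩
  by_contra! hc
  exact ByzSM.not_achievesBSM_static hk hc.2 hc.1 P hP
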